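/- Let $d\ge 3$ and let $\Lambda$ be a full-rank lattice in $\mathbb R^d$. For $\vec x=(x_1,\dots,x_d)\in\mathbb R^d$ put $\Pi(\vec x)=\prod_{1\le i\le d}|x_i|^{1/d}$ and let $|\vec x|=\max_i|x_i|$ be the sup-norm. The Diophantine exponent $\omega(\Lambda)$ is the supremum, in the extended real line, of the real numbers $\gamma$ such that the inequality \[ \Pi(\vec x)\le|\vec x|^{-\gamma} \] has infinitely many solutions $\vec x\in\Lambda$. Let \[ \Lambda^\ast=\{\vec y\in\mathbb R^d : \langle\vec y,\vec x\rangle\in\mathbb Z\text{ for each }\vec x\in\Lambda\} \] be the dual lattice, where $\langle\cdot,\cdot\rangle$ is the standard inner product. If $\omega(\Lambda^\ast)<\infty$, then \[ \omega(\Lambda)\ \ge\ \frac{\omega(\Lambda^\ast)}{(d-1)^2+d(d-2)\,\omega(\Lambda^\ast)}\,, \] and if $\omega(\Lambda^\ast)=\infty$, then \[ \omega(\Lambda)\ \ge\ \frac1{d(d-2)}\,. \] -/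

import Mathlib

/-- `Π(x) = ∏ |xᵢ|^{1/d}`, the geometric mean of the absolute values of the coordinates. -/
noncomputable def coordGeomMean {d : ℕ} (x : Fin d → ℝ) : ℝ :=
  ∏ i, |x i| ^ ((1 : ℝ) / (d : ℝ))

/-- The Diophantine exponent of a set `Λ` of points of `ℝ^d` (used for lattices): the supremum, in
the extended reals, of the real `γ` such that `Π(x) ≤ |x|^{-γ}` has infinitely many solutions
`x ∈ Λ`. The norm of `Fin d → ℝ` is the sup-norm. -/
noncomputable def diophantineExponent {d : ℕ} (Λ : Set (Fin d → ℝ)) : EReal :=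
  sSup ((fun γ : ℝ => (γ : EReal)) ''
    {γ : ℝ | {x : Fin d → ℝ | x ∈ Λ ∧ coordGeomMean x ≤ ‖x‖ ^ (-γ)}.Infinite})

/-- The dual lattice: all `y ∈ ℝ^d` whose standard inner product with each `x ∈ Λ` is an
integer. -/
noncomputable def dualLattice {d : ℕ} (Λ : Submodule ℤ (Fin d → ℝ)) :
    Submodule ℤ (Fin d → ℝ) :=
  LinearMap.BilinForm.dualSubmodule (dotProductBilin ℝ ℝ) Λ

theorem mem_dualLattice_iff {d : ℕ} (Λ : Submodule ℤ (Fin d → ℝ)) (y : Fin d → ℝ) :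
    y ∈ dualLattice Λ ↔ ∀ x ∈ Λ, ∃ n : ℤ, ∑ i, y i * x i = (n : ℝ) := by
  simp [dualLattice, LinearMap.BilinForm.mem_dualSubmodule, Submodule.mem_one, dotProduct, eq_comm]

open Module MeasureTheory Filter Topology

variable {d : ℕ}

/-! ### Lattices, duality and Minkowski's theorem -/

section Lattice

variable (Λ : Submodule ℤ (Fin d → ℝ))

/-! Let `y` in the dual lattice satisfy `Π(y) ≤ Y ^ (-γ)`, with `Y = ‖y‖`. Enclose `y` in a box with
half-sides `η i ≤ Y` and product `H = Y ^ (-dγ)` (`exists_abs_le_prod_eq`). Transference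
(`exists_abs_le_of_mem_dualLattice`) gives a nonzero `x ∈ Λ` with `|x i| * η i ≪ H ^ (1/(d-1))`.
Multiplying over `i` bounds `Π(x)` by `Y ^ (-B)`, and `η i ≥ H / Y ^ (d-1)` bounds `‖x‖` by `Y ^ A`,
up to constants, where `B = γ/(d-1)` and `A = (d-1) + d(d-2)γ/(d-1)`.

Hence every positive `δ < B/A = γ/((d-1)^2 + d(d-2)γ)` is attained for `Λ` infinitely often.
Nonpositive `δ` are covered by `diophantineExponent_nonneg`. -/

theorem dualLattice_eq_span [DiscreteTopology Λ] [IsZLattice ℝ Λ] :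
    ∃ (ι : Type) (_ : Finite ι) (b : Basis ι ℝ (Fin d → ℝ)),
      dualLattice Λ = Submodule.span ℤ (Set.range b) := by
  classical
  let b := Free.chooseBasis ℤ Λ
  let B := b.ofZLatticeBasis ℝ Λ
  have hnd : LinearMap.BilinForm.Nondegenerate
      (dotProductBilin ℝ ℝ : LinearMap.BilinForm ℝ (Fin d → ℝ)) := by
    constructor
    · intro x hx
      exact dotProduct_self_eq_zero.mp (hx x)
    · intro x hx
      exact dotProduct_self_eq_zero.mp (hx x)
  let e : Free.ChooseBasisIndex ℤ Λ ≃ Fin (Fintype.card (Free.ChooseBasisIndex ℤ Λ)) :=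
    Fintype.equivFin _
  let B' := B.reindex e
  refine ⟨_, inferInstance, LinearMap.BilinForm.dualBasis _ hnd B', ?_⟩
  rw [← LinearMap.BilinForm.dualSubmodule_span_of_basis, Basis.range_reindex,
    Basis.ofZLatticeBasis_span]
  rfl

theorem discreteTopology_dualLattice [DiscreteTopology Λ] [IsZLattice ℝ Λ] :
    DiscreteTopology (dualLattice Λ) := by
  obtain ⟨ι, hι, b, hb⟩ := dualLattice_eq_span Λ
  rw [hb]
  infer_instance

theorem finite_inter_of_isBounded [DiscreteTopology Λ] {s : Set (Fin d → ℝ)}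
    (hs : Bornology.IsBounded s) : (s ∩ (Λ : Set (Fin d → ℝ))).Finite := by
  have : DiscreteTopology Λ.toAddSubgroup := inferInstanceAs (DiscreteTopology Λ)
  have hc : IsClosed (Λ.toAddSubgroup : Set (Fin d → ℝ)) := AddSubgroup.isClosed_of_discrete
  exact Metric.finite_isBounded_inter_isClosed
    (SetLike.isDiscrete_iff_discreteTopology.mpr ‹DiscreteTopology Λ›) hs hc

/-- Minkowski's theorem on linear forms. -/
theorem exists_ne_zero_forall_abs_mulVec_lt_one [DiscreteTopology Λ] [IsZLattice ℝ Λ] :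
    ∃ C : ℝ, 0 < C ∧ ∀ M : Matrix (Fin d) (Fin d) ℝ, M.det ≠ 0 → |M.det| ≤ C →
      ∃ x ∈ Λ, x ≠ 0 ∧ ∀ i, |(M.mulVec x) i| < 1 := by
  let b := Free.chooseBasis ℤ Λ
  have hF : volume (ZSpan.fundamentalDomain (b.ofZLatticeBasis ℝ)) ≠ ⊤ :=
    (ZSpan.fundamentalDomain_isBounded (b.ofZLatticeBasis ℝ)).measure_lt_top.ne
  set F := ZSpan.fundamentalDomain (b.ofZLatticeBasis ℝ)
  have hfund : IsAddFundamentalDomain Λ F volume := ZLattice.isAddFundamentalDomain b volume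
  have : Countable Λ.toAddSubgroup := inferInstanceAs (Countable Λ)
  refine ⟨((volume F).toReal + 1)⁻¹, by positivity, fun M hM hC => ?_⟩
  have hdet : LinearMap.det (Matrix.toLin' M) ≠ 0 := by rwa [LinearMap.det_toLin']
  let s : Set (Fin d → ℝ) := Matrix.toLin' M ⁻¹' Metric.ball 0 1
  have hvol : volume F * 2 ^ finrank ℝ (Fin d → ℝ) < volume s := by
    rw [Measure.addHaar_preimage_linearMap _ hdet, LinearMap.det_toLin', Real.volume_pi_ball _ one_pos]
    simp only [finrank_fintype_fun_eq_card, Fintype.card_fin, mul_one]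
    rw [ENNReal.ofReal_pow zero_le_two, ENNReal.ofReal_ofNat]
    refine ENNReal.mul_lt_mul_left (by positivity) (by finiteness) ?_
    rw [ENNReal.lt_ofReal_iff_toReal_lt hF, abs_inv]
    have := (le_inv_comm₀ (abs_pos.mpr hM) (by positivity)).mp hC
    linarith
  obtain ⟨x, hx0, hx⟩ := exists_ne_zero_mem_lattice_of_measure_mul_two_pow_lt_measure
    (L := Λ.toAddSubgroup) (s := s) hfund
    (fun x hx => by simpa [s, Matrix.mulVec_neg] using hx) ((convex_ball 0 1).linear_preimage _) hvol
  refine ⟨x, x.2, by simpa using hx0, fun i => ?_⟩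
  have hx' : ‖M.mulVec x‖ < 1 := by simpa [s] using hx
  exact (norm_le_pi_norm _ i).trans_lt hx'

end Lattice

/-! ### The geometric mean and nonnegativity of the exponent -/

theorem coordGeomMean_eq (x : Fin d → ℝ) :
    coordGeomMean x = (∏ i, |x i|) ^ ((1 : ℝ) / d) :=
  Real.finsetProd_rpow _ _ (fun _ _ => abs_nonneg _) _

theorem coordGeomMean_nonneg (x : Fin d → ℝ) : 0 ≤ coordGeomMean x := by
  rw [coordGeomMean_eq]; positivity

theorem coordGeomMean_pow (hd : d ≠ 0) (x : Fin d → ℝ) :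
    coordGeomMean x ^ d = ∏ i, |x i| := by
  rw [coordGeomMean_eq, one_div, Real.rpow_inv_natCast_pow (by positivity) hd]

theorem coordGeomMean_eq_zero_iff (hd : d ≠ 0) (x : Fin d → ℝ) :
    coordGeomMean x = 0 ↔ ∃ i, x i = 0 := by
  rw [← pow_eq_zero_iff hd, coordGeomMean_pow hd, Finset.prod_eq_zero_iff]
  simp

theorem le_diophantineExponent {Λ : Set (Fin d → ℝ)} {γ : ℝ}
    (h : {x : Fin d → ℝ | x ∈ Λ ∧ coordGeomMean x ≤ ‖x‖ ^ (-γ)}.Infinite) :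
    (γ : EReal) ≤ diophantineExponent Λ :=
  le_sSup ⟨γ, h, rfl⟩

theorem infinite_of_coordGeomMean_eq_zero (hd : d ≠ 0) {Λ : Submodule ℤ (Fin d → ℝ)}
    {x : Fin d → ℝ} (hx : x ∈ Λ) (hx0 : x ≠ 0) (hgm : coordGeomMean x = 0) (γ : ℝ) :
    {x : Fin d → ℝ | x ∈ (Λ : Set (Fin d → ℝ)) ∧ coordGeomMean x ≤ ‖x‖ ^ (-γ)}.Infinite := by
  refine Set.infinite_of_injective_forall_mem (f := fun n : ℤ => n • x)
    (smul_left_injective ℤ hx0) fun n => ⟨Λ.smul_mem n hx, ?_⟩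
  obtain ⟨i, hi⟩ := (coordGeomMean_eq_zero_iff hd x).mp hgm
  rw [(coordGeomMean_eq_zero_iff hd _).mpr ⟨i, by simp [hi]⟩]
  positivity

/-- Different `y` may yield the same `x`, so infinitude is read off from `Π(x)` being arbitrarily
small: a finite set of solutions would have a least positive `Π`. If `Π` vanishes at a nonzero
point, its multiples suffice. -/
theorem infinite_of_forall_exists_coordGeomMean_lt (hd : d ≠ 0) {Λ : Submodule ℤ (Fin d → ℝ)}
    {γ : ℝ} (h : ∀ ε > 0, ∃ x ∈ Λ, x ≠ 0 ∧ coordGeomMean x < ε ∧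
      coordGeomMean x ≤ ‖x‖ ^ (-γ)) :
    {x : Fin d → ℝ | x ∈ (Λ : Set (Fin d → ℝ)) ∧ coordGeomMean x ≤ ‖x‖ ^ (-γ)}.Infinite := by
  by_cases hz : ∃ x ∈ Λ, x ≠ 0 ∧ coordGeomMean x = 0
  · obtain ⟨x, hx, hx0, hgm⟩ := hz
    exact infinite_of_coordGeomMean_eq_zero hd hx hx0 hgm γ
  push Not at hz
  intro hfin
  have hfin' := (hfin.subset (Set.sep_subset _ (fun x => x ≠ 0)))
  obtain ⟨x₁, hx₁, hx₁0, -, hx₁γ⟩ := h 1 one_pos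
  obtain ⟨x₀, ⟨⟨hx₀, -⟩, hx₀0⟩, hmin⟩ :=
    hfin'.exists_minimalFor coordGeomMean _ ⟨x₁, ⟨hx₁, hx₁γ⟩, hx₁0⟩
  obtain ⟨x, hx, hx0, hlt, hxγ⟩ := h (coordGeomMean x₀)
    ((coordGeomMean_nonneg x₀).lt_of_ne' (hz x₀ hx₀ hx₀0))
  exact hlt.not_ge (hmin ⟨⟨hx, hxγ⟩, hx0⟩ hlt.le)

/-- Boxes of fixed volume, ever thinner in one direction, contain infinitely many lattice points
with bounded `Π`; for `γ < 0` the bound `‖x‖ ^ (-γ)` eventually exceeds that constant. -/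
theorem diophantineExponent_nonneg (hd : 2 ≤ d) (Λ : Submodule ℤ (Fin d → ℝ))
    [DiscreteTopology Λ] [IsZLattice ℝ Λ] :
    0 ≤ diophantineExponent (Λ : Set (Fin d → ℝ)) := by
  have hd0 : d ≠ 0 := by omega
  refine EReal.ge_of_forall_gt_iff_ge.mp fun γ hγ => le_diophantineExponent ?_
  have hγ : γ < 0 := by exact_mod_cast hγ
  by_cases hz : ∃ x ∈ Λ, x ≠ 0 ∧ coordGeomMean x = 0
  · obtain ⟨x, hx, hx0, hgm⟩ := hz
    exact infinite_of_coordGeomMean_eq_zero hd0 hx hx0 hgm γ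
  push Not at hz
  obtain ⟨C, hC, hM⟩ := exists_ne_zero_forall_abs_mulVec_lt_one Λ
  let k : Fin d := ⟨0, by omega⟩
  let l : Fin d := ⟨1, by omega⟩
  have hlk : l ≠ k := by simp [k, l]
  have key : ∀ T : ℝ, 0 < T → ∃ x ∈ Λ, x ≠ 0 ∧ |x l| < T⁻¹ ∧ coordGeomMean x ^ d ≤ C⁻¹ := by
    intro T hT
    let a : Fin d → ℝ := Function.update (fun _ => T) k (C * (T ^ (d - 1))⁻¹)
    have hprod : ∏ i, a i = C := by
      rw [Finset.prod_update_of_mem (Finset.mem_univ _)]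
      simp only [Finset.prod_const, ← Finset.erase_eq, Finset.card_erase_of_mem (Finset.mem_univ k),
        Finset.card_univ, Fintype.card_fin]
      field_simp
    obtain ⟨x, hx, hx0, hlt⟩ := hM (Matrix.diagonal a)
      (by rw [Matrix.det_diagonal, hprod]; exact hC.ne')
      (by rw [Matrix.det_diagonal, hprod, abs_of_pos hC])
    simp only [Matrix.mulVec_diagonal, abs_mul] at hlt
    refine ⟨x, hx, hx0, ?_, ?_⟩
    · have := hlt l
      simp only [a, Function.update_of_ne hlk, abs_of_pos hT] at this
      rwa [← one_div, lt_div_iff₀' hT]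
    · rw [coordGeomMean_pow hd0, ← mul_le_mul_iff_right₀ hC, mul_inv_cancel₀ hC.ne']
      calc C * ∏ i, |x i| = ∏ i, |a i| * |x i| := by
            rw [Finset.prod_mul_distrib, ← Finset.abs_prod Finset.univ a, hprod, abs_of_pos hC]
        _ ≤ 1 := Finset.prod_le_one (fun _ _ => by positivity) fun i _ => (hlt i).le
  have hinf : {x : Fin d → ℝ | x ∈ Λ ∧ x ≠ 0 ∧ coordGeomMean x ^ d ≤ C⁻¹}.Infinite := by
    intro hfin
    obtain ⟨x₁, hx₁, hx₁0, -, hx₁C⟩ := key 1 one_pos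
    obtain ⟨x₀, ⟨hx₀, hx₀0, -⟩, hmin⟩ :=
      hfin.exists_minimalFor (fun x => |x l|) _ ⟨x₁, hx₁, hx₁0, hx₁C⟩
    have hpos : 0 < |x₀ l| := abs_pos.mpr fun h0 =>
      hz x₀ hx₀ hx₀0 ((coordGeomMean_eq_zero_iff hd0 _).mpr ⟨l, h0⟩)
    obtain ⟨x, hx, hx0, hlt, hxC⟩ := key (|x₀ l|)⁻¹ (by positivity)
    rw [inv_inv] at hlt
    exact hlt.not_ge (hmin ⟨hx, hx0, hxC⟩ hlt.le)
  set R : ℝ := ((C⁻¹) ^ ((1 : ℝ) / d)) ^ (1 / (-γ)) with hR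
  refine (hinf.sdiff (finite_inter_of_isBounded Λ (Metric.isBounded_closedBall (x := 0) (r := R)))).mono ?_
  rintro x ⟨⟨hx, -, hxC⟩, hxR⟩
  refine ⟨hx, ?_⟩
  have hRx : R ≤ ‖x‖ := by
    by_contra! hlt
    exact hxR ⟨by simpa using hlt.le, hx⟩
  calc coordGeomMean x = (coordGeomMean x ^ d) ^ ((1 : ℝ) / d) := by
        rw [one_div, Real.pow_rpow_inv_natCast (coordGeomMean_nonneg x) hd0]
    _ ≤ (C⁻¹) ^ ((1 : ℝ) / d) :=
        Real.rpow_le_rpow (pow_nonneg (coordGeomMean_nonneg x) d) hxC (by positivity)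
    _ = R ^ (-γ) := by
        rw [hR, ← Real.rpow_mul (by positivity), one_div_mul_cancel (by linarith), Real.rpow_one]
    _ ≤ ‖x‖ ^ (-γ) := Real.rpow_le_rpow (by positivity) hRx (by linarith)

theorem diophantineExponent_dualLattice_nonneg (hd : 2 ≤ d) (Λ : Submodule ℤ (Fin d → ℝ))
    [DiscreteTopology Λ] [IsZLattice ℝ Λ] :
    0 ≤ diophantineExponent (dualLattice Λ : Set (Fin d → ℝ)) := by
  obtain ⟨ι, hι, b, hb⟩ := dualLattice_eq_span Λ
  rw [hb]
  exact diophantineExponent_nonneg hd _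

/-- The transference principle: a dual lattice point in the box with half-sides `η i` yields a
lattice point in the pseudo-compound box. -/
theorem exists_abs_le_of_mem_dualLattice (hd : 2 ≤ d) (Λ : Submodule ℤ (Fin d → ℝ))
    [DiscreteTopology Λ] [IsZLattice ℝ Λ] :
    ∃ c : ℝ, 0 < c ∧ ∀ y ∈ dualLattice Λ, ∀ η : Fin d → ℝ, (∀ i, 0 < η i) →
      (∀ i, |y i| ≤ η i) → (∃ k, |y k| = η k) →
      ∃ x ∈ Λ, x ≠ 0 ∧ ∀ i, |x i| * η i ≤ c * (∏ i, η i) ^ ((1 : ℝ) / ((d : ℝ) - 1)) := by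
  obtain ⟨C, hC, hM⟩ := exists_ne_zero_forall_abs_mulVec_lt_one Λ
  refine ⟨d * (C⁻¹) ^ ((1 : ℝ) / ((d : ℝ) - 1)), by positivity, ?_⟩
  rintro y hy η hη hyη ⟨k, hk⟩
  have hH : 0 < ∏ i, η i := Finset.prod_pos fun i _ => hη i
  set H := ∏ i, η i with hHdef
  set l : ℝ := (C⁻¹ * H) ^ ((1 : ℝ) / ((d : ℝ) - 1)) with hl
  have hlpos : 0 < l := by positivity
  have hlpow : l ^ (d - 1) = C⁻¹ * H := by
    have : ((d - 1 : ℕ) : ℝ) = (d : ℝ) - 1 := by push_cast [show 1 ≤ d by omega]; ring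
    rw [hl, ← this, one_div, Real.rpow_inv_natCast_pow (by positivity) (by omega)]
  let u : Fin d → ℝ := fun i => η i / l
  have hu : ∀ i, 0 < u i := fun i => div_pos (hη i) hlpos
  -- The `k`-th form is `⟨y, x⟩`, an integer on `Λ`, so being less than 1 in absolute value forces
  -- it to vanish. The scale `l` makes the determinant `±C`.
  let M : Matrix (Fin d) (Fin d) ℝ := (Matrix.diagonal u).updateRow k y
  have hMdet : |M.det| = C := by
    have hrow : y = ∑ j, (y j / u j) • (Matrix.diagonal u) j := by
      ext i
      simp only [Finset.sum_apply, Pi.smul_apply, Matrix.diagonal_apply, smul_eq_mul, mul_ite,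
        mul_zero, Finset.sum_ite_eq', Finset.mem_univ, if_true]
      exact (div_mul_cancel₀ _ (hu i).ne').symm
    have : M.det = (y k / u k) * ∏ i, u i := by
      rw [← Matrix.det_diagonal, ← smul_eq_mul,
        ← Matrix.det_updateRow_sum (Matrix.diagonal u) k fun j => y j / u j, ← hrow]
    rw [this, abs_mul, abs_div, hk, abs_of_pos (hu k),
      abs_of_pos (Finset.prod_pos fun i _ => hu i)]
    simp only [u, Finset.prod_div_distrib, Finset.prod_const, Finset.card_univ, Fintype.card_fin]
    rw [← pow_sub_one_mul (show d ≠ 0 by omega) l, hlpow, ← hHdef]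
    have := (hη k).ne'
    field_simp
  obtain ⟨x, hx, hx0, hlt⟩ := hM M (by rw [← abs_pos, hMdet]; exact hC) hMdet.le
  have hne : ∀ i, i ≠ k → |x i| * η i < l := by
    intro i hi
    have h1 := hlt i
    have : M.mulVec x i = u i * x i := by
      simp only [Matrix.mulVec, M, Matrix.updateRow_ne hi]
      exact Matrix.mulVec_diagonal u x i
    rw [this, abs_mul, abs_of_pos (hu i), div_mul_eq_mul_div, div_lt_one hlpos] at h1
    rwa [mul_comm]
  have hyx : ∑ i, y i * x i = 0 := by
    obtain ⟨n, hn⟩ := (mem_dualLattice_iff Λ y).mp hy x hx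
    have h1 := hlt k
    have : M.mulVec x k = n := by
      rw [← hn]
      simp [Matrix.mulVec, M, dotProduct]
    rw [this] at h1
    have : |n| < 1 := by exact_mod_cast h1
    rw [hn, Int.abs_lt_one_iff.mp this, Int.cast_zero]
  have hd1 : (1 : ℝ) ≤ d := by exact_mod_cast (by omega : 1 ≤ d)
  refine ⟨x, hx, hx0, fun i => ?_⟩
  rw [mul_assoc, ← Real.mul_rpow (by positivity) hH.le, ← hl]
  -- The missing coordinate `x k` is recovered from `⟨y, x⟩ = 0`, using `|y k| = η k`.
  by_cases hi : i = k
  · subst hi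
    rw [← Finset.add_sum_erase _ _ (Finset.mem_univ i), add_eq_zero_iff_eq_neg] at hyx
    calc |x i| * η i = |y i * x i| := by rw [abs_mul, hk, mul_comm]
      _ ≤ ∑ j ∈ Finset.univ.erase i, |y j * x j| := by
          rw [hyx, abs_neg]; exact Finset.abs_sum_le_sum_abs _ _
      _ ≤ ∑ j ∈ Finset.univ.erase i, l := by
          refine Finset.sum_le_sum fun j hj => ?_
          rw [abs_mul, mul_comm]
          exact (mul_le_mul_of_nonneg_left (hyη j) (abs_nonneg _)).trans
            (hne j (Finset.ne_of_mem_erase hj)).le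
      _ ≤ ∑ _j : Fin d, l :=
          Finset.sum_le_sum_of_subset_of_nonneg (Finset.erase_subset _ _) fun _ _ _ => hlpos.le
      _ = d * l := by simp
  · exact (hne i hi).le.trans (le_mul_of_one_le_left hlpos.le hd1)

/-- The sides of a box can be enlarged, without exceeding the sup-norm, so that the volume takes a
prescribed value. -/
theorem exists_abs_le_prod_eq (hd : d ≠ 0) (y : Fin d → ℝ) {H : ℝ} (hH : 0 < H)
    (hyH : ∏ i, |y i| ≤ H) (hHy : H ≤ ‖y‖ ^ d) :
    ∃ η : Fin d → ℝ, (∀ i, 0 < η i) ∧ (∀ i, |y i| ≤ η i) ∧ (∀ i, η i ≤ ‖y‖) ∧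
      (∃ k, |y k| = η k) ∧ ∏ i, η i = H := by
  have : Nonempty (Fin d) := ⟨⟨0, Nat.pos_of_ne_zero hd⟩⟩
  have hcont : Continuous fun t : ℝ => ∏ i, max |y i| t := by fun_prop
  have hmem : H ∈ Set.Icc (∏ i, max |y i| 0) (∏ i, max |y i| ‖y‖) := by
    constructor
    · simpa only [fun i => max_eq_left (abs_nonneg (y i))] using hyH
    · have : ∀ i, max |y i| ‖y‖ = ‖y‖ := fun i => max_eq_right (norm_le_pi_norm y i)
      simpa [this] using hHy
  -- Since `t ≤ ‖y‖`, replacing `|y i|` by `max |y i| t` leaves the largest coordinate unchanged; it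
  -- provides `k`.
  obtain ⟨t, ⟨ht0, hty⟩, ht⟩ := intermediate_value_Icc (norm_nonneg y) hcont.continuousOn hmem
  obtain ⟨k, hk⟩ := Finite.exists_max fun i => |y i|
  have hky : ‖y‖ = |y k| := le_antisymm
    ((pi_norm_le_iff_of_nonneg (abs_nonneg _)).mpr hk) (norm_le_pi_norm y k)
  refine ⟨fun i => max |y i| t, fun i => ?_, fun i => le_max_left _ _,
    fun i => max_le (norm_le_pi_norm y i) hty, ⟨k, (max_eq_left (hky ▸ hty)).symm⟩, ht⟩
  refine ((abs_nonneg _).trans (le_max_left _ _)).lt_of_ne' fun h0 => hH.ne' ?_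
  rw [← ht]
  exact Finset.prod_eq_zero (Finset.mem_univ i) h0

theorem exists_mem_lattice_coordGeomMean_le (hd : 2 ≤ d) (Λ : Submodule ℤ (Fin d → ℝ))
    [DiscreteTopology Λ] [IsZLattice ℝ Λ] :
    ∃ c : ℝ, 0 < c ∧ ∀ γ : ℝ, 0 < γ → ∀ y ∈ dualLattice Λ, 1 ≤ ‖y‖ →
      coordGeomMean y ≤ ‖y‖ ^ (-γ) →
      ∃ x ∈ Λ, x ≠ 0 ∧ coordGeomMean x ≤ c * ‖y‖ ^ (-(γ / ((d : ℝ) - 1))) ∧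
        ‖x‖ ≤ c * ‖y‖ ^ (((d : ℝ) - 1) + d * (d - 2) * γ / (d - 1)) := by
  have hd0 : d ≠ 0 := by omega
  obtain ⟨c, hc, htr⟩ := exists_abs_le_of_mem_dualLattice hd Λ
  refine ⟨c, hc, fun γ hγ y hy hy1 hyγ => ?_⟩
  have hdR : (2 : ℝ) ≤ d := by exact_mod_cast hd
  have hd1 : (d : ℝ) - 1 ≠ 0 := by linarith
  have hdR0 : (d : ℝ) ≠ 0 := by linarith
  have hY : 0 < ‖y‖ := by linarith
  set Y := ‖y‖ with hYdef
  have hHd : (Y ^ (-γ)) ^ d = Y ^ (-(d * γ)) := by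
    rw [← Real.rpow_mul_natCast hY.le]; ring_nf
  obtain ⟨η, hη, hyη, hηY, hk, hprod⟩ := exists_abs_le_prod_eq hd0 y
    (H := Y ^ (-(d * γ))) (by positivity)
    (by
      rw [← coordGeomMean_pow hd0, ← hHd]
      exact pow_le_pow_left₀ (coordGeomMean_nonneg y) hyγ d)
    (by
      rw [← Real.rpow_natCast]
      exact Real.rpow_le_rpow_of_exponent_le hy1 (by nlinarith))
  obtain ⟨x, hx, hx0, hxη⟩ := htr y hy η hη hyη hk
  rw [hprod, ← Real.rpow_mul hY.le] at hxη
  refine ⟨x, hx, hx0, ?_, ?_⟩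
  · refine le_of_pow_le_pow_left₀ hd0 (by positivity) ?_
    rw [coordGeomMean_pow hd0]
    have h1 : (∏ i, |x i|) * ∏ i, η i ≤ (c * Y ^ (-(d * γ) * (1 / ((d : ℝ) - 1)))) ^ d := by
      rw [← Finset.prod_mul_distrib]
      refine (Finset.prod_le_prod (fun i _ => mul_nonneg (abs_nonneg _) (hη i).le)
        fun i _ => hxη i).trans_eq ?_
      simp
    rw [hprod, ← le_div_iff₀ (by positivity)] at h1
    refine h1.trans_eq ?_
    rw [mul_pow, mul_pow, mul_div_assoc, ← Real.rpow_mul_natCast hY.le,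
      ← Real.rpow_mul_natCast hY.le, ← Real.rpow_sub hY]
    congr 2
    field_simp
    ring
  · refine (pi_norm_le_iff_of_nonneg (by positivity)).mpr fun i => ?_
    have h2 : Y ^ (-(d * γ)) ≤ η i * Y ^ ((d : ℝ) - 1) := by
      rw [← hprod, ← Finset.mul_prod_erase _ _ (Finset.mem_univ i)]
      refine mul_le_mul_of_nonneg_left ?_ (hη i).le
      refine (Finset.prod_le_prod (fun j _ => (hη j).le) fun j _ => hηY j).trans_eq ?_
      rw [Finset.prod_const, Finset.card_erase_of_mem (Finset.mem_univ i), Finset.card_univ,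
        Fintype.card_fin, ← Real.rpow_natCast, Nat.cast_sub (by omega), Nat.cast_one]
    rw [Real.norm_eq_abs]
    refine le_of_mul_le_mul_right ?_ (show 0 < Y ^ (-(d * γ)) by positivity)
    calc |x i| * Y ^ (-(d * γ)) ≤ |x i| * (η i * Y ^ ((d : ℝ) - 1)) :=
          mul_le_mul_of_nonneg_left h2 (abs_nonneg _)
      _ = |x i| * η i * Y ^ ((d : ℝ) - 1) := by ring
      _ ≤ c * Y ^ (-(d * γ) * (1 / ((d : ℝ) - 1))) * Y ^ ((d : ℝ) - 1) :=
          mul_le_mul_of_nonneg_right (hxη i) (by positivity)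
      _ = c * Y ^ (((d : ℝ) - 1) + d * (d - 2) * γ / (d - 1)) * Y ^ (-(d * γ)) := by
          rw [mul_assoc, mul_assoc, ← Real.rpow_add hY, ← Real.rpow_add hY]
          congr 2
          field_simp
          ring

/-! ### Comparison of the exponents -/

theorem infinite_of_infinite_dualLattice (hd : 2 ≤ d) (Λ : Submodule ℤ (Fin d → ℝ))
    [DiscreteTopology Λ] [IsZLattice ℝ Λ] {γ δ : ℝ} (hγ : 0 < γ) (hδ : 0 < δ)
    (h : δ * (((d : ℝ) - 1) ^ 2 + d * (d - 2) * γ) < γ)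
    (hinf : {y : Fin d → ℝ | y ∈ (dualLattice Λ : Set (Fin d → ℝ)) ∧
      coordGeomMean y ≤ ‖y‖ ^ (-γ)}.Infinite) :
    {x : Fin d → ℝ | x ∈ (Λ : Set (Fin d → ℝ)) ∧ coordGeomMean x ≤ ‖x‖ ^ (-δ)}.Infinite := by
  have := discreteTopology_dualLattice Λ
  obtain ⟨c, hc, htr⟩ := exists_mem_lattice_coordGeomMean_le hd Λ
  have hd1 : (0 : ℝ) < (d : ℝ) - 1 := by
    have : (2 : ℝ) ≤ d := by exact_mod_cast hd
    linarith
  refine infinite_of_forall_exists_coordGeomMean_lt (by omega) fun ε hε => ?_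
  set A : ℝ := ((d : ℝ) - 1) + d * (d - 2) * γ / (d - 1) with hA
  set B : ℝ := γ / ((d : ℝ) - 1) with hB
  have hAB : A * δ < B := by
    rw [hB, lt_div_iff₀ hd1, hA]
    refine lt_of_eq_of_lt ?_ h
    field_simp
  have hB0 : 0 < B := by positivity
  have t1 : Tendsto (fun Y : ℝ => c * Y ^ (-B)) atTop (𝓝 0) := by
    simpa using (tendsto_rpow_neg_atTop hB0).const_mul c
  -- The strict gap `A * δ < B` absorbs the constants in the bounds for `Π(x)` and `‖x‖`.
  have t2 : Tendsto (fun Y : ℝ => (c * c ^ δ) * Y ^ (-(B - A * δ))) atTop (𝓝 0) := by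
    simpa using (tendsto_rpow_neg_atTop (sub_pos.mpr hAB)).const_mul (c * c ^ δ)
  obtain ⟨R, hR⟩ := eventually_atTop.mp
    ((t1.eventually_lt_const hε).and ((t2.eventually_lt_const one_pos).and (eventually_ge_atTop 1)))
  obtain ⟨y, ⟨hy, hyγ⟩, hyR⟩ := (hinf.sdiff (finite_inter_of_isBounded (dualLattice Λ)
    (Metric.isBounded_closedBall (x := 0) (r := R)))).nonempty
  have hRy : R ≤ ‖y‖ := by
    by_contra! hlt
    exact hyR ⟨by simpa using hlt.le, hy⟩
  obtain ⟨h1, h2, h3⟩ := hR ‖y‖ hRy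
  have hY : 0 < ‖y‖ := by linarith
  obtain ⟨x, hx, hx0, hgm, hnorm⟩ := htr γ hγ y hy h3 hyγ
  refine ⟨x, hx, hx0, hgm.trans_lt h1, hgm.trans ?_⟩
  have hxpos : 0 < ‖x‖ := norm_pos_iff.mpr hx0
  rw [Real.rpow_neg hxpos.le, le_inv_comm₀ (by positivity) (by positivity)]
  calc ‖x‖ ^ δ ≤ (c * ‖y‖ ^ A) ^ δ := Real.rpow_le_rpow hxpos.le hnorm hδ.le
    _ = c ^ δ * ‖y‖ ^ (A * δ) := by
        rw [Real.mul_rpow hc.le (by positivity), ← Real.rpow_mul hY.le]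
    _ ≤ (c * ‖y‖ ^ (-B))⁻¹ := by
        rw [← one_div, le_div_iff₀ (by positivity)]
        refine le_trans (le_of_eq ?_) h2.le
        rw [show -(B - A * δ) = A * δ + -B by ring, Real.rpow_add hY]
        ring

/-- The condition `δ < w / ((d-1)^2 + d(d-2)w)` solved for `w`; in this form it also makes sense for
`w = ⊤`, so both cases of the theorem follow. -/
theorem le_diophantineExponent_of_lt (hd : 3 ≤ d) (Λ : Submodule ℤ (Fin d → ℝ))
    [DiscreteTopology Λ] [IsZLattice ℝ Λ] {δ : ℝ} (hδ : δ * (d * (d - 2)) < 1)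
    (h : ((δ * ((d : ℝ) - 1) ^ 2 / (1 - δ * (d * (d - 2))) : ℝ) : EReal) <
      diophantineExponent (dualLattice Λ : Set (Fin d → ℝ))) :
    (δ : EReal) ≤ diophantineExponent (Λ : Set (Fin d → ℝ)) := by
  obtain hδ0 | hδ0 := le_or_gt δ 0
  · exact le_trans (by exact_mod_cast hδ0) (diophantineExponent_nonneg (by omega) Λ)
  obtain ⟨_, ⟨γ, hγ, rfl⟩, hlt⟩ := lt_sSup_iff.mp h
  have hlt : δ * ((d : ℝ) - 1) ^ 2 / (1 - δ * (d * (d - 2))) < γ := EReal.coe_lt_coe_iff.mp hlt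
  have hpos : 0 < 1 - δ * (d * (d - 2)) := by linarith
  have hγ0 : 0 < γ := lt_of_le_of_lt (by positivity) hlt
  rw [div_lt_iff₀ hpos] at hlt
  exact le_diophantineExponent
    (infinite_of_infinite_dualLattice (by omega) Λ hγ0 hδ0 (by linarith) hγ)

theorem theorem1 (d : ℕ) (hd : 3 ≤ d) (Λ : Submodule ℤ (Fin d → ℝ))
    [DiscreteTopology Λ] [IsZLattice ℝ Λ] :
    (diophantineExponent (dualLattice Λ : Set (Fin d → ℝ)) ≠ ⊤ →
      diophantineExponent (dualLattice Λ : Set (Fin d → ℝ)) /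
          (((((d : ℝ) - 1) ^ 2 : ℝ) : EReal) +
            (((d : ℝ) * ((d : ℝ) - 2) : ℝ) : EReal) *
              diophantineExponent (dualLattice Λ : Set (Fin d → ℝ))) ≤
        diophantineExponent (Λ : Set (Fin d → ℝ))) ∧
    (diophantineExponent (dualLattice Λ : Set (Fin d → ℝ)) = ⊤ →
      ((1 / ((d : ℝ) * ((d : ℝ) - 2)) : ℝ) : EReal) ≤
        diophantineExponent (Λ : Set (Fin d → ℝ))) := by
  have hdR : (3 : ℝ) ≤ d := by exact_mod_cast hd
  have ha : 0 < ((d : ℝ) - 1) ^ 2 := by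
    have : 0 < (d : ℝ) - 1 := by linarith
    positivity
  have hb : 0 < (d : ℝ) * ((d : ℝ) - 2) := mul_pos (by linarith) (by linarith)
  constructor
  · intro htop
    have h0 := diophantineExponent_dualLattice_nonneg (by omega) Λ
    obtain ⟨w, hw⟩ : ∃ w : ℝ, (w : EReal) =
        diophantineExponent (dualLattice Λ : Set (Fin d → ℝ)) :=
      ⟨_, EReal.coe_toReal htop (ne_bot_of_le_ne_bot EReal.zero_ne_bot h0)⟩
    have hw0 : 0 ≤ w := by rw [← hw] at h0; exact_mod_cast h0
    rw [← hw, ← EReal.coe_mul, ← EReal.coe_add, ← EReal.coe_div]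
    refine EReal.ge_of_forall_gt_iff_ge.mp fun δ hδ => ?_
    have hδ : δ < w / (((d : ℝ) - 1) ^ 2 + d * (d - 2) * w) := by exact_mod_cast hδ
    have hden : 0 < ((d : ℝ) - 1) ^ 2 + d * (d - 2) * w := by positivity
    rw [lt_div_iff₀ hden] at hδ
    have hδ1 : δ * (d * (d - 2)) < 1 := by
      by_contra! hge
      have h1 : 0 < δ := pos_of_mul_pos_left (by linarith) hb.le
      nlinarith [mul_pos h1 ha]
    refine le_diophantineExponent_of_lt hd Λ hδ1 ?_
    rw [← hw, EReal.coe_lt_coe_iff, div_lt_iff₀ (by linarith)]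
    linarith
  · intro htop
    refine EReal.ge_of_forall_gt_iff_ge.mp fun δ hδ => ?_
    have hδ : δ < 1 / ((d : ℝ) * (d - 2)) := by exact_mod_cast hδ
    refine le_diophantineExponent_of_lt hd Λ ((lt_div_iff₀ hb).mp hδ) ?_
    rw [htop]
    exact EReal.coe_lt_top _
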